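/- For a matrix algebra $\mathbb{B}(H)$ over a finite-dimensional nonzero complex Hilbert space $H$, a density operator is a positive semidefinite operator of trace one, and its von Neumann entropy is $H(\rho)=-\mathrm{tr}(\rho\log\rho)$. For a density operator $\rho_{MC}$ on $H_M\otimes H_C$ let $\rho_C=(\mathrm{tr}_M\otimes\mathrm{id}_C)(\rho_{MC})$ and $H(M|C)_\rho=H(\rho_{MC})-H(\rho_C)$. A quantum channel is a completely positive trace-preserving linear map. For quantum channels $\Phi_A:\mathbb{B}(H_M)\to\mathbb{B}(H_A)$ and $\Phi_B:\mathbb{B}(H_M)\to\mathbb{B}(H_B)$ with common input space, define the minimal uncertainty \[ I^{sq}(\Phi_A,\Phi_B)=\inf_{H_C}\ \inf_{\rho_{MC}}\Big(H(A|C)_{(\Phi_A\otimes\mathrm{id}_C)(\rho)}+H(B|C)_{(\Phi_B\otimes\mathrm{id}_C)(\rho)}-H(M|C)_\rho\Big), \] where the infimum runs over memory spaces $H_C$ of all finite dimensions and all density operators $\rho_{MC}$ on $H_M\otimes H_C$. Theorem. $I^{sq}$ is additive: for any two pairs of quantum channels $\Phi_A:\mathbb{B}(H_{M_1})\to\mathbb{B}(H_{A_1})$,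 $\Phi_B:\mathbb{B}(H_{M_1})\to\mathbb{B}(H_{B_1})$ and $\Psi_A:\mathbb{B}(H_{M_2})\to\mathbb{B}(H_{A_2})$, $\Psi_B:\mathbb{B}(H_{M_2})\to\mathbb{B}(H_{B_2})$ between finite-dimensional matrix algebras, \[ I^{sq}(\Phi_A\otimes\Psi_A,\Phi_B\otimes\Psi_B)=I^{sq}(\Phi_A,\Phi_B)+I^{sq}(\Psi_A,\Psi_B). \] -/

import Mathlib

namespace SquashedUncertainty

open scoped Kronecker ComplexOrder

/-- The tensor product `Φ ⊗ Ψ` of linear maps between matrix algebras, where `M_m ⊗ M_n` is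
identified with the matrices indexed by `m × n`. It is the unique linear map sending
`x ⊗ₖ y` to `Φ x ⊗ₖ Ψ y`, see `kronMap_kronecker` and `kronMap_unique`. -/
def kronMap {m n a b : Type*}
    (Φ : Matrix m m ℂ →ₗ[ℂ] Matrix a a ℂ) (Ψ : Matrix n n ℂ →ₗ[ℂ] Matrix b b ℂ) :
    Matrix (m × n) (m × n) ℂ →ₗ[ℂ] Matrix (a × b) (a × b) ℂ where
  toFun X := Matrix.of fun s t =>
    Φ (Matrix.of fun p p' => Ψ (Matrix.of fun q q' => X (p, q) (p', q')) s.2 t.2) s.1 t.1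
  map_add' X Y := by
    ext s t
    have h1 : ∀ p p', (Matrix.of fun q q' => (X + Y) (p, q) (p', q')) =
        (Matrix.of fun q q' => X (p, q) (p', q')) + Matrix.of fun q q' => Y (p, q) (p', q') :=
      fun _ _ => rfl
    have h2 : (Matrix.of fun p p' => Ψ (Matrix.of fun q q' => (X + Y) (p, q) (p', q')) s.2 t.2) =
        (Matrix.of fun p p' => Ψ (Matrix.of fun q q' => X (p, q) (p', q')) s.2 t.2) +
        Matrix.of fun p p' => Ψ (Matrix.of fun q q' => Y (p, q) (p', q')) s.2 t.2 := by
      ext p p'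
      rw [Matrix.of_apply, h1, map_add]
      rfl
    rw [Matrix.of_apply, h2, map_add]
    rfl
  map_smul' c X := by
    ext s t
    have h1 : ∀ p p', (Matrix.of fun q q' => (c • X) (p, q) (p', q')) =
        c • (Matrix.of fun q q' => X (p, q) (p', q')) := fun _ _ => rfl
    have h2 : (Matrix.of fun p p' => Ψ (Matrix.of fun q q' => (c • X) (p, q) (p', q')) s.2 t.2) =
        c • (Matrix.of fun p p' => Ψ (Matrix.of fun q q' => X (p, q) (p', q')) s.2 t.2) := by
      ext p p'
      rw [Matrix.of_apply, h1, map_smul]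
      rfl
    rw [Matrix.of_apply, h2, map_smul]
    rfl

theorem kronMap_kronecker {m n a b : Type*}
    (Φ : Matrix m m ℂ →ₗ[ℂ] Matrix a a ℂ) (Ψ : Matrix n n ℂ →ₗ[ℂ] Matrix b b ℂ)
    (x : Matrix m m ℂ) (y : Matrix n n ℂ) :
    kronMap Φ Ψ (x ⊗ₖ y) = Φ x ⊗ₖ Ψ y := by
  ext s t
  have h1 : ∀ p p', (Matrix.of fun q q' => (x ⊗ₖ y) (p, q) (p', q')) = x p p' • y :=
    fun _ _ => rfl
  have h2 : (Matrix.of fun p p' => Ψ (Matrix.of fun q q' => (x ⊗ₖ y) (p, q) (p', q')) s.2 t.2) =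
      Ψ y s.2 t.2 • x := by
    ext p p'
    simp only [Matrix.of_apply, h1, map_smul, Matrix.smul_apply, smul_eq_mul, mul_comm]
  change Φ (Matrix.of fun p p' => Ψ (Matrix.of fun q q' => (x ⊗ₖ y) (p, q) (p', q')) s.2 t.2)
    s.1 t.1 = Φ x s.1 t.1 * Ψ y s.2 t.2
  rw [h2, map_smul, Matrix.smul_apply, smul_eq_mul, mul_comm]

theorem kronMap_unique {m n a b : Type*} [Finite m] [Finite n]
    (Φ : Matrix m m ℂ →ₗ[ℂ] Matrix a a ℂ) (Ψ : Matrix n n ℂ →ₗ[ℂ] Matrix b b ℂ)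
    (T : Matrix (m × n) (m × n) ℂ →ₗ[ℂ] Matrix (a × b) (a × b) ℂ)
    (hT : ∀ x y, T (x ⊗ₖ y) = Φ x ⊗ₖ Ψ y) : T = kronMap Φ Ψ := by
  classical
  apply Matrix.ext_linearMap ℂ
  rintro ⟨i, j⟩ ⟨i', j'⟩
  apply LinearMap.ext
  intro c
  have h : Matrix.single (i, j) (i', j') c =
      (Matrix.single i i' c) ⊗ₖ (Matrix.single j j' (1 : ℂ)) := by
    rw [Matrix.single_kronecker_single, mul_one]
  simp only [LinearMap.comp_apply, Matrix.singleLinearMap_apply, h, hT, kronMap_kronecker]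

/-- Density operators: positive semidefinite of trace one. -/
def IsDensity {n : Type*} [Fintype n] (ρ : Matrix n n ℂ) : Prop :=
  ρ.PosSemidef ∧ ρ.trace = 1

/-- Quantum channels: completely positive trace preserving maps. -/
structure IsChannel {m a : Type*} [Fintype m] [Fintype a]
    (Φ : Matrix m m ℂ →ₗ[ℂ] Matrix a a ℂ) : Prop where
  completelyPositive : ∀ (n : ℕ) (X : Matrix (m × Fin n) (m × Fin n) ℂ), X.PosSemidef →
    (kronMap Φ (LinearMap.id : Matrix (Fin n) (Fin n) ℂ →ₗ[ℂ] Matrix (Fin n) (Fin n) ℂ)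
      X).PosSemidef
  tracePreserving : ∀ x : Matrix m m ℂ, (Φ x).trace = x.trace

/-- The von Neumann entropy `H(ρ) = -tr(ρ log ρ)`, with natural logarithm; `log` is applied by
functional calculus, and `0 log 0 = 0` because `Real.log 0 = 0`. -/
noncomputable def entropy {n : Type*} [Fintype n] [DecidableEq n] (ρ : Matrix n n ℂ) : ℝ :=
  -(ρ * cfc Real.log ρ).trace.re

/-- The reduced operator `ρ_C = (tr_M ⊗ id_C)(ρ_MC)`. -/
def reduced {m c : Type*} [Fintype m] (ρ : Matrix (m × c) (m × c) ℂ) : Matrix c c ℂ :=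
  Matrix.of fun k l => ∑ i, ρ (i, k) (i, l)

/-- The conditional entropy `H(M|C)_ρ = H(ρ_MC) - H(ρ_C)`. -/
noncomputable def condEntropy {m c : Type*} [Fintype m] [Fintype c] [DecidableEq m]
    [DecidableEq c] (ρ : Matrix (m × c) (m × c) ℂ) : ℝ :=
  entropy ρ - entropy (reduced ρ)

/-- The generalized conditional mutual information
`I(Φ_A, Φ_B | C)_ρ = H(A|C) + H(B|C) - H(M|C)`, the first two terms being evaluated at
`(Φ_A ⊗ id_C)(ρ)` and `(Φ_B ⊗ id_C)(ρ)`. -/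
noncomputable def condInfo {m a b c : Type*} [Fintype m] [Fintype a] [Fintype b] [Fintype c]
    [DecidableEq m] [DecidableEq a] [DecidableEq b] [DecidableEq c]
    (ΦA : Matrix m m ℂ →ₗ[ℂ] Matrix a a ℂ) (ΦB : Matrix m m ℂ →ₗ[ℂ] Matrix b b ℂ)
    (ρ : Matrix (m × c) (m × c) ℂ) : ℝ :=
  condEntropy (kronMap ΦA (LinearMap.id : Matrix c c ℂ →ₗ[ℂ] Matrix c c ℂ) ρ)
    + condEntropy (kronMap ΦB (LinearMap.id : Matrix c c ℂ →ₗ[ℂ] Matrix c c ℂ) ρ)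
    - condEntropy ρ

/-- `I(Φ_A, Φ_B | C)`: the infimum over all states `ρ_MC`, for a fixed memory system `C`. The
infimum is taken in the extended reals, so that it is a genuine infimum. -/
noncomputable def minUncertaintyWith {m a b : Type*} [Fintype m] [Fintype a] [Fintype b]
    [DecidableEq m] [DecidableEq a] [DecidableEq b] (c : Type*) [Fintype c] [DecidableEq c]
    (ΦA : Matrix m m ℂ →ₗ[ℂ] Matrix a a ℂ) (ΦB : Matrix m m ℂ →ₗ[ℂ] Matrix b b ℂ) : EReal :=
  ⨅ ρ : {ρ : Matrix (m × c) (m × c) ℂ // IsDensity ρ}, (condInfo ΦA ΦB ρ.1 : EReal)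

/-- `I^sq(Φ_A, Φ_B)`: the infimum over memory systems of all finite dimensions. -/
noncomputable def minUncertainty {m a b : Type*} [Fintype m] [Fintype a] [Fintype b]
    [DecidableEq m] [DecidableEq a] [DecidableEq b]
    (ΦA : Matrix m m ℂ →ₗ[ℂ] Matrix a a ℂ) (ΦB : Matrix m m ℂ →ₗ[ℂ] Matrix b b ℂ) : EReal :=
  ⨅ d : ℕ, minUncertaintyWith (Fin d) ΦA ΦB

end SquashedUncertainty

/-!
The chain rule `H(M₁M₂|C) = H(M₁|M₂C) + H(M₂|C)` splits the uncertainty of the tensor product of two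
pairs of channels into two terms, one for each pair, except that the channels of the second pair
also act on the part of the memory that belongs to the first term. By data processing, a channel
applied to the memory can only increase the conditional entropy, so the uncertainty of the tensor
product is at least the sum of the two uncertainties; product states give the reverse inequality.

Data processing amounts to monotonicity of the relative entropy, which equals the increment over
`[0, 1]` of `∑ᵢⱼ |⟨uᵢ, vⱼ⟩|² pᵢ log ((1 - t) qⱼ + t pᵢ)`, where `pᵢ, uᵢ` and `qⱼ, vⱼ` diagonalize
the two operators. Up to the factor `1 - t` and an additive constant, the derivative of this
function at `t ∈ (0, 1)` is the maximum of a concave quadratic form in a matrix variable. A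
trace-preserving map that is positive over `2 × 2` blocks pulls each value of the form of its output
back to a larger value of the form of its input, and integrating over `t` gives the monotonicity.
-/

namespace SquashedUncertainty

open scoped Kronecker ComplexOrder Matrix
open Matrix

section Diagonalization

variable {n k : Type*} [Fintype n] [DecidableEq n] [Fintype k] [DecidableEq k]

/-- `ρ = U diag(p) Uᴴ` with `U` unitary and `p` real, not necessarily in any particular order. -/
structure IsDiagonalization (U : Matrix n n ℂ) (p : n → ℝ) (ρ : Matrix n n ℂ) : Prop where
  unitary : Uᴴ * U = 1
  eq : ρ = U * diagonal (fun i => (p i : ℂ)) * Uᴴ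

theorem isDiagonalization_eigenvalues {ρ : Matrix n n ℂ} (h : ρ.IsHermitian) :
    IsDiagonalization (h.eigenvectorUnitary : Matrix n n ℂ) h.eigenvalues ρ where
  unitary := Unitary.coe_star_mul_self h.eigenvectorUnitary
  eq := h.spectral_theorem

theorem exists_isDiagonalization {ρ : Matrix n n ℂ} (h : ρ.PosSemidef) :
    ∃ U p, IsDiagonalization U p ρ ∧ ∀ i, 0 ≤ p i :=
  ⟨_, _, isDiagonalization_eigenvalues h.1, h.eigenvalues_nonneg⟩

theorem isDiagonalization_one : IsDiagonalization (1 : Matrix n n ℂ) (fun _ => 1) 1 where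
  unitary := by rw [conjTranspose_one, one_mul]
  eq := by simp

namespace IsDiagonalization

variable {U : Matrix n n ℂ} {p : n → ℝ} {ρ : Matrix n n ℂ}

theorem unitary' (hU : IsDiagonalization U p ρ) : U * Uᴴ = 1 :=
  mul_eq_one_comm.mp hU.unitary

theorem isHermitian (hU : IsDiagonalization U p ρ) : ρ.IsHermitian := by
  rw [hU.eq]
  refine isHermitian_mul_mul_conjTranspose U (isHermitian_diagonal_of_self_adjoint _ ?_)
  exact funext fun i => Complex.conj_ofReal (p i)

theorem trace_conj (hU : IsDiagonalization U p ρ) (M : Matrix n n ℂ) :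
    (U * M * Uᴴ).trace = M.trace := by
  rw [trace_mul_cycle, hU.unitary, Matrix.one_mul]

theorem conj_eq_diagonal (hU : IsDiagonalization U p ρ) :
    Uᴴ * ρ * U = diagonal fun i => (p i : ℂ) := by
  calc Uᴴ * ρ * U = (Uᴴ * U) * diagonal (fun i => (p i : ℂ)) * (Uᴴ * U) := by
        rw [hU.eq]; simp only [Matrix.mul_assoc]
    _ = _ := by rw [hU.unitary, Matrix.one_mul, Matrix.mul_one]

theorem kronecker (hU : IsDiagonalization U p ρ) {V : Matrix k k ℂ} {q : k → ℝ}
    {σ : Matrix k k ℂ} (hV : IsDiagonalization V q σ) :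
    IsDiagonalization (U ⊗ₖ V) (fun s => p s.1 * q s.2) (ρ ⊗ₖ σ) where
  unitary := by
    rw [conjTranspose_kronecker, ← mul_kronecker_mul, hU.unitary, hV.unitary, one_kronecker_one]
  eq := by
    rw [hU.eq, hV.eq, conjTranspose_kronecker, mul_kronecker_mul, mul_kronecker_mul,
      diagonal_kronecker_diagonal]
    simp only [Complex.ofReal_mul]

/-- Two diagonalizations of `ρ` are intertwined by a unitary that is supported on pairs of equal
eigenvalues, hence also intertwines any function of the eigenvalues. -/
theorem map_diagonal_eq (hU : IsDiagonalization U p ρ) {V : Matrix n n ℂ} {q : n → ℝ}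
    (hV : IsDiagonalization V q ρ) (f : ℝ → ℝ) :
    U * diagonal (fun i => (f (p i) : ℂ)) * Uᴴ = V * diagonal (fun i => (f (q i) : ℂ)) * Vᴴ := by
  have hp : Vᴴ * U * diagonal (fun i => (p i : ℂ)) = diagonal (fun i => (q i : ℂ)) * (Vᴴ * U) := by
    rw [← hU.conj_eq_diagonal, ← hV.conj_eq_diagonal]
    calc Vᴴ * U * (Uᴴ * ρ * U) = Vᴴ * (U * Uᴴ) * ρ * U := by simp only [Matrix.mul_assoc]
      _ = Vᴴ * ρ * (V * Vᴴ) * U := by rw [hU.unitary', hV.unitary', Matrix.mul_one, Matrix.mul_one]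
      _ = Vᴴ * ρ * V * (Vᴴ * U) := by simp only [Matrix.mul_assoc]
  have hf : Vᴴ * U * diagonal (fun i => (f (p i) : ℂ)) =
      diagonal (fun i => (f (q i) : ℂ)) * (Vᴴ * U) := by
    ext j i
    have hji := congrFun₂ hp j i
    rw [mul_diagonal, diagonal_mul] at hji ⊢
    by_cases h : (Vᴴ * U) j i = 0
    · rw [h, zero_mul, mul_zero]
    · rw [mul_comm] at hji
      rw [Complex.ofReal_injective (mul_right_cancel₀ h hji), mul_comm]
  calc U * diagonal (fun i => (f (p i) : ℂ)) * Uᴴ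
      = V * (Vᴴ * U * diagonal (fun i => (f (p i) : ℂ))) * Uᴴ := by
        simp only [← Matrix.mul_assoc, hV.unitary', Matrix.one_mul]
    _ = V * diagonal (fun i => (f (q i) : ℂ)) * Vᴴ := by
        rw [hf]; simp only [Matrix.mul_assoc, hU.unitary', Matrix.mul_one]

theorem cfc_eq (hU : IsDiagonalization U p ρ) (f : ℝ → ℝ) :
    cfc f ρ = U * diagonal (fun i => (f (p i) : ℂ)) * Uᴴ := by
  rw [hU.isHermitian.cfc_eq]
  exact (isDiagonalization_eigenvalues hU.isHermitian).map_diagonal_eq hU f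

theorem trace_mul_cfc (hU : IsDiagonalization U p ρ) (f : ℝ → ℝ) (X : Matrix n n ℂ) :
    (X * cfc f ρ).trace = ∑ i, (Uᴴ * X * U) i i * f (p i) := by
  rw [hU.cfc_eq f, ← Matrix.mul_assoc, trace_mul_comm, ← Matrix.mul_assoc, ← Matrix.mul_assoc]
  simp only [trace, diag_apply, mul_diagonal]

theorem trace_eq (hU : IsDiagonalization U p ρ) : ρ.trace = ((∑ i, p i : ℝ) : ℂ) := by
  rw [hU.eq, hU.trace_conj, trace_diagonal, Complex.ofReal_sum]

theorem entropy_eq (hU : IsDiagonalization U p ρ) : entropy ρ = ∑ i, Real.negMulLog (p i) := by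
  rw [entropy, hU.trace_mul_cfc, hU.conj_eq_diagonal]
  simp only [diagonal_apply_eq, ← Complex.ofReal_mul, ← Complex.ofReal_sum, Complex.ofReal_re,
    Real.negMulLog, neg_mul, Finset.sum_neg_distrib]

theorem submatrix (hU : IsDiagonalization U p ρ) (e : k ≃ n) :
    IsDiagonalization (U.submatrix e e) (fun i => p (e i)) (ρ.submatrix e e) where
  unitary := by
    rw [conjTranspose_submatrix, submatrix_mul_equiv, hU.unitary, submatrix_one_equiv]
  eq := by
    have hdiag : diagonal (fun i => (p (e i) : ℂ)) =
        (diagonal fun i => (p i : ℂ)).submatrix e e :=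
      (submatrix_diagonal_equiv (fun i => (p i : ℂ)) e).symm
    rw [hdiag, conjTranspose_submatrix, submatrix_mul_equiv, submatrix_mul_equiv, ← hU.eq]

end IsDiagonalization

theorem entropy_submatrix {ρ : Matrix n n ℂ} (h : ρ.IsHermitian) (e : k ≃ n) :
    entropy (ρ.submatrix e e) = entropy ρ := by
  have hU := isDiagonalization_eigenvalues h
  rw [hU.entropy_eq, (hU.submatrix e).entropy_eq]
  exact e.sum_comp fun i => Real.negMulLog (h.eigenvalues i)

theorem entropy_kronecker {ρ : Matrix n n ℂ} {σ : Matrix k k ℂ} (hρ : IsDensity ρ)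
    (hσ : IsDensity σ) : entropy (ρ ⊗ₖ σ) = entropy ρ + entropy σ := by
  have hU := isDiagonalization_eigenvalues hρ.1.1
  have hV := isDiagonalization_eigenvalues hσ.1.1
  have hp : ∑ i, hρ.1.1.eigenvalues i = 1 := by exact_mod_cast hU.trace_eq.symm.trans hρ.2
  have hq : ∑ i, hσ.1.1.eigenvalues i = 1 := by exact_mod_cast hV.trace_eq.symm.trans hσ.2
  rw [(hU.kronecker hV).entropy_eq, hU.entropy_eq, hV.entropy_eq, Fintype.sum_prod_type]
  simp only [Real.negMulLog_mul, Finset.sum_add_distrib, ← Finset.mul_sum, ← Finset.sum_mul, hp,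
    hq, one_mul]

end Diagonalization

section Positivity

variable {m a n c d k : Type*}

theorem kronMap_id_submatrix (Φ : Matrix m m ℂ →ₗ[ℂ] Matrix a a ℂ)
    (X : Matrix (m × c) (m × c) ℂ) (f : d → c) :
    kronMap Φ .id (X.submatrix (Prod.map id f) (Prod.map id f)) =
      (kronMap Φ .id X).submatrix (Prod.map id f) (Prod.map id f) :=
  rfl

/-- The map `Φ ⊗ id` preserves positive semidefiniteness on matrices with an extra index in `d`.
For `d = Fin k` this is `k`-positivity. -/
def IsPositiveOver (d : Type*) (Φ : Matrix m m ℂ →ₗ[ℂ] Matrix a a ℂ) : Prop :=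
  ∀ X : Matrix (m × d) (m × d) ℂ, X.PosSemidef → (kronMap Φ .id X).PosSemidef

theorem IsChannel.isPositiveOver [Fintype m] [Fintype a] [Finite d]
    {Φ : Matrix m m ℂ →ₗ[ℂ] Matrix a a ℂ} (hΦ : IsChannel Φ) : IsPositiveOver d Φ := by
  intro X hX
  obtain ⟨r, ⟨e⟩⟩ := Finite.exists_equiv_fin d
  have h := (hΦ.completelyPositive r _ (hX.submatrix (Prod.map id e.symm))).submatrix
    (Prod.map id e)
  rwa [← kronMap_id_submatrix, submatrix_submatrix, Prod.map_comp_map, e.symm_comp_self,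
    Function.id_comp, Prod.map_id, submatrix_id_id] at h

namespace IsPositiveOver

variable [Finite m] [Fintype n] {Φ : Matrix m m ℂ →ₗ[ℂ] Matrix a a ℂ} {Z : Matrix n n ℂ}

theorem posSemidef_blocks [Finite d] (hΦ : IsPositiveOver d Φ) (hZ : Z.PosSemidef)
    (B : d → Matrix m n ℂ) :
    (of fun s t : a × d => Φ (B s.2 * Z * (B t.2)ᴴ) s.1 t.1).PosSemidef :=
  hΦ _ (hZ.mul_mul_conjTranspose_same (of fun s : m × d => B s.2 s.1))

theorem posSemidef_sum [Fintype a] [Fintype d] [Finite k] (hΦ : IsPositiveOver d Φ)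
    (hZ : Z.PosSemidef) (B : d → Matrix m n ℂ) (C : d → Matrix k a ℂ) :
    (∑ s, ∑ t, C s * Φ (B s * Z * (B t)ᴴ) * (C t)ᴴ).PosSemidef := by
  convert (hΦ.posSemidef_blocks hZ B).mul_mul_conjTranspose_same (of fun i s => C s.2 i s.1)
  ext i j
  simp only [Matrix.sum_apply, mul_apply, conjTranspose_apply, of_apply,
    Fintype.sum_prod_type_right, Finset.sum_mul]
  rw [Finset.sum_comm]
  exact Finset.sum_congr rfl fun _ _ => Finset.sum_comm

theorem posSemidef [Finite d] [Nonempty d] (hΦ : IsPositiveOver d Φ) {Z : Matrix m m ℂ}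
    (hZ : Z.PosSemidef) : (Φ Z).PosSemidef := by
  classical
  cases nonempty_fintype m
  have h := hΦ.posSemidef_blocks hZ fun _ => 1
  simp only [Matrix.one_mul, conjTranspose_one, Matrix.mul_one] at h
  exact h.submatrix fun i => (i, Classical.arbitrary d)

theorem map_conjTranspose (hΦ : IsPositiveOver (Fin 2) Φ) (W : Matrix m m ℂ) :
    Φ Wᴴ = (Φ W)ᴴ := by
  classical
  cases nonempty_fintype m
  have h := (hΦ.posSemidef_blocks (PosSemidef.one (n := m)) ![1, Wᴴ]).1
  ext i j
  simpa using (h.apply (i, 1) (j, 0)).symm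

theorem trace_conj_le [Fintype m] [Fintype a] {Φ : Matrix m m ℂ →ₗ[ℂ] Matrix a a ℂ}
    (hΦ : IsPositiveOver (Fin 2) Φ) (htr : ∀ x, (Φ x).trace = x.trace) {X Z : Matrix m m ℂ}
    {Y : Matrix a a ℂ} (hXY : ∀ W, (Y * Φ W).trace = (X * W).trace) (hZ : Z.PosSemidef) :
    (X * Z * Xᴴ).trace ≤ (Y * Φ Z * Yᴴ).trace := by
  classical
  have hnn := (hΦ.posSemidef_sum hZ ![1, X] ![Y, -1]).trace_nonneg
  have hcross : (Φ (X * Z) * Yᴴ).trace = (X * Z * Xᴴ).trace := by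
    have hstar : X * Z = (Z * Xᴴ)ᴴ := by
      rw [conjTranspose_mul, conjTranspose_conjTranspose, hZ.1.eq]
    rw [hstar, hΦ.map_conjTranspose, ← conjTranspose_mul, trace_conjTranspose, hXY,
      ← trace_conjTranspose, conjTranspose_mul, trace_mul_comm]
  simp only [Fin.sum_univ_two, cons_val_zero, cons_val_one, Matrix.one_mul, conjTranspose_one,
    Matrix.mul_one, conjTranspose_neg, Matrix.neg_mul, Matrix.mul_neg, neg_neg, trace_add,
    trace_neg, hXY, htr, hcross, ← Matrix.mul_assoc] at hnn
  rwa [neg_add_cancel, add_zero, ← sub_eq_add_neg, sub_nonneg] at hnn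

end IsPositiveOver

theorem exists_trace_mul_eq {R : Type*} [CommRing R] [Fintype m] [Fintype n]
    (f : Matrix m n R →ₗ[R] R) : ∃ X : Matrix n m R, ∀ W, (X * W).trace = f W := by
  classical
  let X : Matrix n m R := of fun j i => f (single i j 1)
  suffices (traceLinearMap n R R).comp (mulLeftLinearMap n R X) = f from
    ⟨X, fun W => LinearMap.congr_fun this W⟩
  refine Matrix.ext_linearMap R fun i j => LinearMap.ext_ring ?_
  simp [X, trace_mul_single]

end Positivity

section Reduced

variable {m a c d : Type*} [Fintype m] [Fintype a]

theorem reduced_eq_sum_submatrix (ρ : Matrix (m × c) (m × c) ℂ) :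
    reduced ρ = ∑ i, ρ.submatrix (Prod.mk i) (Prod.mk i) := by
  ext k l
  simp only [reduced, of_apply, Matrix.sum_apply, submatrix_apply]

theorem reduced_posSemidef {ρ : Matrix (m × c) (m × c) ℂ} (h : ρ.PosSemidef) :
    (reduced ρ).PosSemidef := by
  rw [reduced_eq_sum_submatrix]
  exact posSemidef_sum _ fun i _ => h.submatrix (Prod.mk i)

theorem trace_reduced [Fintype c] (ρ : Matrix (m × c) (m × c) ℂ) :
    (reduced ρ).trace = ρ.trace := by
  simp only [trace, diag_apply, reduced, of_apply]
  rw [Fintype.sum_prod_type_right]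

theorem reduced_kronMap {Φ : Matrix m m ℂ →ₗ[ℂ] Matrix a a ℂ}
    (hΦ : ∀ x, (Φ x).trace = x.trace) (Ψ : Matrix c c ℂ →ₗ[ℂ] Matrix d d ℂ)
    (ρ : Matrix (m × c) (m × c) ℂ) : reduced (kronMap Φ Ψ ρ) = Ψ (reduced ρ) := by
  ext j k
  rw [reduced_eq_sum_submatrix ρ, map_sum, Matrix.sum_apply]
  exact hΦ (of fun p p' => Ψ (of fun q q' => ρ (p, q) (p', q')) j k)

theorem trace_kronMap [Fintype c] [Fintype d] {Φ : Matrix m m ℂ →ₗ[ℂ] Matrix a a ℂ}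
    {Ψ : Matrix c c ℂ →ₗ[ℂ] Matrix d d ℂ} (hΦ : ∀ x, (Φ x).trace = x.trace)
    (hΨ : ∀ y, (Ψ y).trace = y.trace) (ρ : Matrix (m × c) (m × c) ℂ) :
    (kronMap Φ Ψ ρ).trace = ρ.trace := by
  rw [← trace_reduced, reduced_kronMap hΦ, hΨ, trace_reduced]

end Reduced

section TensorProductOfChannels

variable {m a n b c d : Type*}

theorem kronMap_comp_kronMap [Finite m] [Finite n] {a' b' : Type*}
    (Φ : Matrix m m ℂ →ₗ[ℂ] Matrix a a ℂ) (Φ' : Matrix a a ℂ →ₗ[ℂ] Matrix a' a' ℂ)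
    (Ψ : Matrix n n ℂ →ₗ[ℂ] Matrix b b ℂ) (Ψ' : Matrix b b ℂ →ₗ[ℂ] Matrix b' b' ℂ) :
    kronMap Φ' Ψ' ∘ₗ kronMap Φ Ψ = kronMap (Φ' ∘ₗ Φ) (Ψ' ∘ₗ Ψ) :=
  kronMap_unique _ _ _ fun x y => by
    rw [LinearMap.comp_apply, kronMap_kronecker, kronMap_kronecker]
    rfl

theorem kronMap_id_left (Ψ : Matrix n n ℂ →ₗ[ℂ] Matrix b b ℂ) (X : Matrix (a × n) (a × n) ℂ) :
    kronMap .id Ψ X =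
      (kronMap Ψ .id (X.submatrix Prod.swap Prod.swap)).submatrix Prod.swap Prod.swap :=
  rfl

theorem IsPositiveOver.kronMap_id {Φ : Matrix m m ℂ →ₗ[ℂ] Matrix a a ℂ}
    (hΦ : IsPositiveOver (c × d) Φ) :
    IsPositiveOver d (kronMap Φ (.id : Matrix c c ℂ →ₗ[ℂ] Matrix c c ℂ)) := fun _ hX =>
  (hΦ _ (hX.submatrix (Equiv.prodAssoc m c d).symm)).submatrix (Equiv.prodAssoc a c d)

theorem IsPositiveOver.posSemidef_kronMap [Finite m] [Finite n]
    {Φ : Matrix m m ℂ →ₗ[ℂ] Matrix a a ℂ} {Ψ : Matrix n n ℂ →ₗ[ℂ] Matrix b b ℂ}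
    (hΦ : IsPositiveOver n Φ) (hΨ : IsPositiveOver a Ψ) {X : Matrix (m × n) (m × n) ℂ}
    (hX : X.PosSemidef) : (kronMap Φ Ψ X).PosSemidef := by
  have hcomp : kronMap Φ Ψ X = kronMap .id Ψ (kronMap Φ .id X) :=
    (LinearMap.congr_fun (kronMap_comp_kronMap Φ .id .id Ψ) X).symm
  rw [hcomp, kronMap_id_left]
  exact (hΨ _ ((hΦ X hX).submatrix Prod.swap)).submatrix Prod.swap

theorem isChannel_id [Fintype m] : IsChannel (.id : Matrix m m ℂ →ₗ[ℂ] Matrix m m ℂ) where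
  completelyPositive _ _ hX := hX
  tracePreserving _ := rfl

variable [Fintype m] [Fintype a] [Fintype n] [Fintype b]
  {Φ : Matrix m m ℂ →ₗ[ℂ] Matrix a a ℂ} {Ψ : Matrix n n ℂ →ₗ[ℂ] Matrix b b ℂ}

theorem IsChannel.kronMap (hΦ : IsChannel Φ) (hΨ : IsChannel Ψ) : IsChannel (kronMap Φ Ψ) where
  completelyPositive _ _ hX :=
    (hΦ.isPositiveOver.posSemidef_kronMap hΨ.isPositiveOver.kronMap_id
      (hX.submatrix (Equiv.prodAssoc m n _).symm)).submatrix (Equiv.prodAssoc a b _)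
  tracePreserving := trace_kronMap hΦ.tracePreserving hΨ.tracePreserving

theorem IsChannel.posSemidef (hΦ : IsChannel Φ) {ρ : Matrix m m ℂ} (hρ : ρ.PosSemidef) :
    (Φ ρ).PosSemidef :=
  (hΦ.isPositiveOver (d := Unit)).posSemidef hρ

theorem IsChannel.isDensity (hΦ : IsChannel Φ) {ρ : Matrix m m ℂ} (hρ : IsDensity ρ) :
    IsDensity (Φ ρ) :=
  ⟨hΦ.posSemidef hρ.1, (hΦ.tracePreserving ρ).trans hρ.2⟩

end TensorProductOfChannels

section LogIntegral

variable {I J : Type*} [Fintype I] [Fintype J]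

theorem hasDerivAt_sum_mul_log {w x y : I → ℝ} (hpos : ∀ s, w s ≠ 0 → 0 < x s ∧ 0 < y s) {t : ℝ}
    (ht : t ∈ Set.Icc (0 : ℝ) 1) :
    HasDerivAt (fun t => ∑ s, w s * Real.log ((1 - t) * y s + t * x s))
      (∑ s, w s * ((x s - y s) / ((1 - t) * y s + t * x s))) t := by
  refine HasDerivAt.fun_sum fun s _ => ?_
  by_cases hw : w s = 0
  · simpa only [hw, zero_mul] using hasDerivAt_const t (0 : ℝ)
  obtain ⟨hx, hy⟩ := hpos s hw
  have hmix : 0 < (1 - t) * y s + t * x s := by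
    rcases ht.1.eq_or_lt with rfl | h0
    · simpa using hy
    · nlinarith [mul_pos h0 hx, mul_nonneg (sub_nonneg.mpr ht.2) hy.le]
  have hlin : HasDerivAt (fun t => (1 - t) * y s + t * x s) (x s - y s) t := by
    have h := (((hasDerivAt_id' t).const_sub 1).mul_const (y s)).fun_add
      ((hasDerivAt_id' t).mul_const (x s))
    simpa only [neg_mul, one_mul, neg_add_eq_sub] using h
  exact (hlin.log hmix.ne').const_mul (w s)

theorem one_sub_mul_sum_mul_div {w x y : I → ℝ} (hpos : ∀ s, w s ≠ 0 → 0 < x s ∧ 0 < y s) {t : ℝ}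
    (ht : t ∈ Set.Ioo (0 : ℝ) 1) :
    (1 - t) * ∑ s, w s * ((x s - y s) / ((1 - t) * y s + t * x s)) =
      ∑ s, w s * x s / ((1 - t) * y s + t * x s) - ∑ s, w s := by
  rw [Finset.mul_sum, ← Finset.sum_sub_distrib]
  refine Finset.sum_congr rfl fun s _ => ?_
  by_cases hw : w s = 0
  · simp only [hw, zero_mul, mul_zero, zero_div, sub_zero]
  obtain ⟨hx, hy⟩ := hpos s hw
  have hmix : (1 - t) * y s + t * x s ≠ 0 :=
    (add_pos (mul_pos (sub_pos.mpr ht.2) hy) (mul_pos ht.1 hx)).ne'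
  field_simp
  ring

/-- `log x - log y` is the integral over `t ∈ (0, 1)` of `(x / m - 1) / (1 - t)`, where
`m = (1 - t) * y + t * x`. -/
theorem sum_mul_log_sub_log_le {w x y : I → ℝ} {w' x' y' : J → ℝ}
    (hpos : ∀ s, w s ≠ 0 → 0 < x s ∧ 0 < y s) (hpos' : ∀ s, w' s ≠ 0 → 0 < x' s ∧ 0 < y' s)
    (hsum : ∑ s, w s = ∑ s, w' s)
    (hle : ∀ t ∈ Set.Ioo (0 : ℝ) 1, ∑ s, w' s * x' s / ((1 - t) * y' s + t * x' s) ≤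
      ∑ s, w s * x s / ((1 - t) * y s + t * x s)) :
    ∑ s, w' s * (Real.log (x' s) - Real.log (y' s)) ≤
      ∑ s, w s * (Real.log (x s) - Real.log (y s)) := by
  have hderiv := fun (t : ℝ) (ht : t ∈ Set.Icc (0 : ℝ) 1) =>
    (hasDerivAt_sum_mul_log hpos ht).sub (hasDerivAt_sum_mul_log hpos' ht)
  have hmono := monotoneOn_of_deriv_nonneg (convex_Icc 0 1)
    (fun t ht => (hderiv t ht).continuousAt.continuousWithinAt)
    (fun t ht => (hderiv t (interior_subset ht)).differentiableAt.differentiableWithinAt)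
    fun t ht => by
      rw [(hderiv t (interior_subset ht)).deriv]
      rw [interior_Icc] at ht
      refine nonneg_of_mul_nonneg_right ?_ (sub_pos.mpr ht.2)
      rw [mul_sub, one_sub_mul_sum_mul_div hpos ht, one_sub_mul_sum_mul_div hpos' ht, hsum]
      linarith [hle t ht]
  have h01 := hmono (Set.left_mem_Icc.mpr zero_le_one) (Set.right_mem_Icc.mpr zero_le_one)
    zero_le_one
  simp only [Pi.sub_apply, sub_zero, one_mul, zero_mul, add_zero, sub_self, zero_add] at h01
  simp only [mul_sub, Finset.sum_sub_distrib]
  linarith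

end LogIntegral

section RelativeEntropy

variable {m k : Type*} [Fintype k] [DecidableEq k]

theorem mul_diagonal_mul_conjTranspose_apply_self (M : Matrix m k ℂ)
    (p : k → ℝ) (i : m) :
    (M * diagonal (fun j => (p j : ℂ)) * Mᴴ) i i =
      ((∑ j, Complex.normSq (M i j) * p j : ℝ) : ℂ) := by
  rw [mul_apply, Complex.ofReal_sum]
  refine Finset.sum_congr rfl fun j _ => ?_
  rw [mul_diagonal, conjTranspose_apply, RCLike.star_def, mul_right_comm, Complex.mul_conj,
    Complex.ofReal_mul]

theorem re_trace_mul_diagonal_mul_conjTranspose [Fintype m] (M : Matrix m k ℂ)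
    (p : k → ℝ) :
    (M * diagonal (fun j => (p j : ℂ)) * Mᴴ).trace.re =
      ∑ s : m × k, p s.2 * Complex.normSq (M s.1 s.2) := by
  simp only [trace, diag_apply, mul_diagonal_mul_conjTranspose_apply_self, ← Complex.ofReal_sum,
    Complex.ofReal_re, Fintype.sum_prod_type, mul_comm]

variable {n : Type*} [Fintype n] {U V : Matrix n n ℂ}

/-- The squared modulus of the inner product of column `i` of `U` and column `j` of `V`. -/
noncomputable def overlap (U V : Matrix n n ℂ) (i j : n) : ℝ :=
  Complex.normSq ((Vᴴ * U) j i)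

theorem overlap_nonneg (i j : n) : 0 ≤ overlap U V i j :=
  Complex.normSq_nonneg _

variable [DecidableEq n] {p q : n → ℝ} {ρ σ : Matrix n n ℂ} {t : ℝ}

/-- The relative entropy `tr ρ (log ρ - log σ)`. Since `Real.log 0 = 0`, this is the usual quantity
only when the kernel of `σ` is contained in that of `ρ`. -/
noncomputable def relEntropy (ρ σ : Matrix n n ℂ) : ℝ :=
  (ρ * (cfc Real.log ρ - cfc Real.log σ)).trace.re

namespace IsDiagonalization

theorem conj_apply_self (hU : IsDiagonalization U p ρ) (V : Matrix n n ℂ) (j : n) :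
    (Vᴴ * ρ * V) j j = ((∑ i, overlap U V i j * p i : ℝ) : ℂ) := by
  have h : Vᴴ * ρ * V = (Vᴴ * U) * diagonal (fun i => (p i : ℂ)) * (Vᴴ * U)ᴴ := by
    rw [hU.eq]
    simp only [conjTranspose_mul, conjTranspose_conjTranspose, Matrix.mul_assoc]
  rw [h, mul_diagonal_mul_conjTranspose_apply_self]
  rfl

theorem sum_overlap (hU : IsDiagonalization U p ρ) (hV : IsDiagonalization V q σ) (i : n) :
    ∑ j, overlap U V i j = 1 := by
  have h : (Vᴴ * U)ᴴ * (Vᴴ * U) = 1 := by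
    calc (Vᴴ * U)ᴴ * (Vᴴ * U) = Uᴴ * (V * Vᴴ) * U := by
          simp only [conjTranspose_mul, conjTranspose_conjTranspose, Matrix.mul_assoc]
      _ = 1 := by rw [hV.unitary', Matrix.mul_one, hU.unitary]
  have hi := congrFun₂ h i i
  simp only [Matrix.mul_apply (M := (Vᴴ * U)ᴴ), conjTranspose_apply, RCLike.star_def,
    ← Complex.normSq_eq_conj_mul_self, one_apply_eq] at hi
  exact_mod_cast hi

theorem sum_overlap_mul_left (hU : IsDiagonalization U p ρ) (hV : IsDiagonalization V q σ)
    (f : n → ℝ) : ∑ s : n × n, overlap U V s.1 s.2 * f s.1 = ∑ i, f i := by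
  simp only [Fintype.sum_prod_type, ← Finset.sum_mul, hU.sum_overlap hV, one_mul]

theorem relEntropy_eq (hU : IsDiagonalization U p ρ) (hV : IsDiagonalization V q σ) :
    relEntropy ρ σ =
      ∑ s : n × n, overlap U V s.1 s.2 * p s.1 * (Real.log (p s.1) - Real.log (q s.2)) := by
  have hρ : (ρ * cfc Real.log ρ).trace.re =
      ∑ s : n × n, overlap U V s.1 s.2 * p s.1 * Real.log (p s.1) := by
    rw [hU.trace_mul_cfc, hU.conj_eq_diagonal]
    simp only [mul_assoc, hU.sum_overlap_mul_left hV fun i => p i * Real.log (p i),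
      diagonal_apply_eq, ← Complex.ofReal_mul, ← Complex.ofReal_sum, Complex.ofReal_re]
  have hσ : (ρ * cfc Real.log σ).trace.re =
      ∑ s : n × n, overlap U V s.1 s.2 * p s.1 * Real.log (q s.2) := by
    rw [hV.trace_mul_cfc, Fintype.sum_prod_type_right]
    simp only [hU.conj_apply_self, ← Complex.ofReal_mul, ← Complex.ofReal_sum, Complex.ofReal_re,
      Finset.sum_mul]
  simp only [relEntropy, trace_sub, Complex.sub_re, hρ, hσ, mul_sub,
    Finset.sum_sub_distrib]

theorem pos_of_overlap_mul_ne_zero (hU : IsDiagonalization U p ρ) (hV : IsDiagonalization V q σ)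
    (hp : ∀ i, 0 ≤ p i) (hq : ∀ i, 0 ≤ q i) {c : ℝ} (hc : (c • σ - ρ).PosSemidef) {i j : n}
    (h : overlap U V i j * p i ≠ 0) : 0 < p i ∧ 0 < q j := by
  have hle : ∑ i, overlap U V i j * p i ≤ c * q j := by
    have hdiag := (hc.conjTranspose_mul_mul_same V).diag_nonneg (i := j)
    rw [Matrix.mul_sub, Matrix.sub_mul, Matrix.mul_smul, Matrix.smul_mul, hV.conj_eq_diagonal,
      Matrix.sub_apply, Matrix.smul_apply, diagonal_apply_eq, hU.conj_apply_self, Complex.real_smul,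
      ← Complex.ofReal_mul, ← Complex.ofReal_sub, Complex.zero_le_real] at hdiag
    exact sub_nonneg.mp hdiag
  have hnn : ∀ i ∈ Finset.univ, 0 ≤ overlap U V i j * p i := fun i _ =>
    mul_nonneg (overlap_nonneg i j) (hp i)
  refine ⟨(hp i).lt_of_ne' (right_ne_zero_of_mul h), (hq j).lt_of_ne' fun hj => h ?_⟩
  rw [hj, mul_zero] at hle
  exact (Finset.sum_eq_zero_iff_of_nonneg hnn).mp (hle.antisymm (Finset.sum_nonneg hnn)) i
    (Finset.mem_univ i)

end IsDiagonalization

/-- A concave quadratic function of `X`, whose maximum is expressed through the eigenvalues of `ρ`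
and `σ` and contracts under two-positive trace-preserving maps. -/
noncomputable def quasiForm (ρ σ : Matrix n n ℂ) (t : ℝ) (X : Matrix n n ℂ) : ℝ :=
  2 * (X * ρ).trace.re - (1 - t) * (X * σ * Xᴴ).trace.re - t * (Xᴴ * ρ * X).trace.re

theorem quasiForm_conj (hU : IsDiagonalization U p ρ) (hV : IsDiagonalization V q σ)
    (Y : Matrix n n ℂ) :
    quasiForm ρ σ t (U * Y * Vᴴ) = ∑ s : n × n, (2 * ((Y s.1 s.2 * (Vᴴ * U) s.2 s.1).re * p s.1) -
      ((1 - t) * q s.2 + t * p s.1) * Complex.normSq (Y s.1 s.2)) := by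
  have hlin : (U * Y * Vᴴ * ρ).trace.re =
      ∑ s : n × n, (Y s.1 s.2 * (Vᴴ * U) s.2 s.1).re * p s.1 := by
    have h : U * Y * Vᴴ * ρ = U * (Y * (Vᴴ * U) * (diagonal fun i => (p i : ℂ))) * Uᴴ := by
      rw [hU.eq]
      simp only [Matrix.mul_assoc]
    rw [h, hU.trace_conj]
    simp only [trace, diag_apply, mul_diagonal, Matrix.mul_apply (M := Y), Fintype.sum_prod_type,
      Complex.re_sum, Complex.re_mul_ofReal, Finset.sum_mul]
  have hσ : (U * Y * Vᴴ * σ * (U * Y * Vᴴ)ᴴ).trace.re =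
      ∑ s : n × n, q s.2 * Complex.normSq (Y s.1 s.2) := by
    have h : U * Y * Vᴴ * σ * (U * Y * Vᴴ)ᴴ = U * (Y * (Vᴴ * σ * V) * Yᴴ) * Uᴴ := by
      simp only [conjTranspose_mul, conjTranspose_conjTranspose, Matrix.mul_assoc]
    rw [h, hU.trace_conj, hV.conj_eq_diagonal, re_trace_mul_diagonal_mul_conjTranspose]
  have hρ : ((U * Y * Vᴴ)ᴴ * ρ * (U * Y * Vᴴ)).trace.re =
      ∑ s : n × n, p s.1 * Complex.normSq (Y s.1 s.2) := by
    have h : (U * Y * Vᴴ)ᴴ * ρ * (U * Y * Vᴴ) = V * (Yᴴ * (Uᴴ * ρ * U) * (Yᴴ)ᴴ) * Vᴴ := by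
      simp only [conjTranspose_mul, conjTranspose_conjTranspose, Matrix.mul_assoc]
    rw [h, hV.trace_conj, hU.conj_eq_diagonal, re_trace_mul_diagonal_mul_conjTranspose,
      Fintype.sum_prod_type_right, Fintype.sum_prod_type]
    simp only [conjTranspose_apply, RCLike.star_def, Complex.normSq_conj]
  rw [quasiForm, hlin, hσ, hρ]
  simp only [Finset.mul_sum, ← Finset.sum_sub_distrib]
  exact Finset.sum_congr rfl fun s _ => by ring

theorem two_mul_re_mul_sub_eq_sub_normSq_div {a m : ℝ} (h : m = 0 → a = 0) (g z : ℂ) :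
    2 * ((z * g).re * a) - m * Complex.normSq z =
      Complex.normSq g * a * a / m - Complex.normSq (m * z - a * star g) / m := by
  by_cases hm : m = 0
  · simp only [hm, h hm, mul_zero, zero_mul, div_zero, sub_zero]
  · field_simp
    simp only [Complex.normSq_apply, Complex.mul_re, Complex.mul_im, Complex.sub_re,
      Complex.sub_im, RCLike.star_def, Complex.conj_re, Complex.conj_im, Complex.ofReal_re,
      Complex.ofReal_im]
    ring

theorem isGreatest_range_quasiForm (hU : IsDiagonalization U p ρ) (hV : IsDiagonalization V q σ)
    (hp : ∀ i, 0 ≤ p i) (hq : ∀ i, 0 ≤ q i) (ht : t ∈ Set.Ioo (0 : ℝ) 1) :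
    IsGreatest (Set.range (quasiForm ρ σ t))
      (∑ s : n × n, overlap U V s.1 s.2 * p s.1 * p s.1 / ((1 - t) * q s.2 + t * p s.1)) := by
  let m : n × n → ℝ := fun s => (1 - t) * q s.2 + t * p s.1
  have hq' : ∀ j, 0 ≤ (1 - t) * q j := fun j => mul_nonneg (sub_nonneg.mpr ht.2.le) (hq j)
  have hp' : ∀ i, 0 ≤ t * p i := fun i => mul_nonneg ht.1.le (hp i)
  have hm : ∀ s, 0 ≤ m s := fun s => add_nonneg (hq' s.2) (hp' s.1)
  have hm0 : ∀ s, m s = 0 → p s.1 = 0 := fun s hs =>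
    (mul_eq_zero.mp ((add_eq_zero_iff_of_nonneg (hq' s.2) (hp' s.1)).mp hs).2).resolve_left ht.1.ne'
  constructor
  · refine ⟨U * (of fun i j => (p i : ℂ) / m (i, j) * star ((Vᴴ * U) j i)) * Vᴴ, ?_⟩
    rw [quasiForm_conj hU hV]
    refine Finset.sum_congr rfl fun s _ => ?_
    rw [two_mul_re_mul_sub_eq_sub_normSq_div (hm0 s)]
    have h : (m s : ℂ) * ((p s.1 : ℂ) / m s) = p s.1 := by
      exact_mod_cast mul_div_cancel_of_imp' (hm0 s)
    rw [of_apply, ← mul_assoc, h, sub_self, Complex.normSq_zero, zero_div, sub_zero]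
    rfl
  · rintro _ ⟨X, rfl⟩
    have hX : X = U * (Uᴴ * X * V) * Vᴴ := by
      calc X = U * Uᴴ * X * (V * Vᴴ) := by
            rw [hU.unitary', hV.unitary', Matrix.one_mul, Matrix.mul_one]
        _ = _ := by simp only [Matrix.mul_assoc]
    rw [hX, quasiForm_conj hU hV]
    refine Finset.sum_le_sum fun s _ => ?_
    rw [two_mul_re_mul_sub_eq_sub_normSq_div (hm0 s)]
    exact sub_le_self _ (div_nonneg (Complex.normSq_nonneg _) (hm s))

end RelativeEntropy

section DataProcessing

variable {n k : Type*} [Fintype n] [Fintype k] {N : Matrix n n ℂ →ₗ[ℂ] Matrix k k ℂ}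
  {ρ σ : Matrix n n ℂ}

theorem exists_quasiForm_map_le (hN : IsPositiveOver (Fin 2) N)
    (htr : ∀ x, (N x).trace = x.trace) (hρ : ρ.PosSemidef) (hσ : σ.PosSemidef) {t : ℝ}
    (ht : t ∈ Set.Icc (0 : ℝ) 1) (Y : Matrix k k ℂ) :
    ∃ X, quasiForm (N ρ) (N σ) t Y ≤ quasiForm ρ σ t X := by
  obtain ⟨X, hX⟩ := exists_trace_mul_eq (traceLinearMap k ℂ ℂ ∘ₗ mulLeftLinearMap k ℂ Y ∘ₗ N)
  have hXY : ∀ W, (Y * N W).trace = (X * W).trace := fun W => (hX W).symm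
  have hXY' : ∀ W, (Yᴴ * N W).trace = (Xᴴ * W).trace := fun W => by
    rw [trace_mul_comm, trace_mul_comm Xᴴ, ← conjTranspose_conjTranspose W, hN.map_conjTranspose,
      ← conjTranspose_mul, ← conjTranspose_mul, trace_conjTranspose, trace_conjTranspose, hXY]
  refine ⟨X, ?_⟩
  have hσle := (Complex.le_def.mp (hN.trace_conj_le htr hXY hσ)).1
  have hρle := (Complex.le_def.mp (hN.trace_conj_le htr hXY' hρ)).1
  rw [conjTranspose_conjTranspose, conjTranspose_conjTranspose] at hρle
  have h1 := mul_le_mul_of_nonneg_left hσle (sub_nonneg.mpr ht.2)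
  have h2 := mul_le_mul_of_nonneg_left hρle ht.1
  rw [quasiForm, quasiForm, hXY]
  linarith

theorem relEntropy_map_le [DecidableEq n] [DecidableEq k] (hN : IsPositiveOver (Fin 2) N)
    (htr : ∀ x, (N x).trace = x.trace) (hρ : ρ.PosSemidef) (hσ : σ.PosSemidef) {c : ℝ}
    (hc : (c • σ - ρ).PosSemidef) : relEntropy (N ρ) (N σ) ≤ relEntropy ρ σ := by
  have hc' : (c • N σ - N ρ).PosSemidef := by
    rw [← LinearMap.map_smul_of_tower, ← map_sub]
    exact hN.posSemidef hc
  obtain ⟨U, p, hU, hp⟩ := exists_isDiagonalization hρ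
  obtain ⟨V, q, hV, hq⟩ := exists_isDiagonalization hσ
  obtain ⟨U', p', hU', hp'⟩ := exists_isDiagonalization (hN.posSemidef hρ)
  obtain ⟨V', q', hV', hq'⟩ := exists_isDiagonalization (hN.posSemidef hσ)
  rw [hU.relEntropy_eq hV, hU'.relEntropy_eq hV']
  refine sum_mul_log_sub_log_le (fun s => hU.pos_of_overlap_mul_ne_zero hV hp hq hc)
    (fun s => hU'.pos_of_overlap_mul_ne_zero hV' hp' hq' hc') ?_ fun t ht => ?_
  · have h := htr ρ
    rw [hU.trace_eq, hU'.trace_eq] at h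
    rw [hU.sum_overlap_mul_left hV, hU'.sum_overlap_mul_left hV']
    exact_mod_cast h.symm
  · obtain ⟨⟨Y, hY⟩, -⟩ := isGreatest_range_quasiForm hU' hV' hp' hq' ht
    obtain ⟨X, hX⟩ := exists_quasiForm_map_le hN htr hρ hσ (Set.Ioo_subset_Icc_self ht) Y
    exact (hY.symm.le.trans hX).trans
      ((isGreatest_range_quasiForm hU hV hp hq ht).2 (Set.mem_range_self X))

end DataProcessing

section ConditionalEntropy

variable {a c d : Type*} [Fintype a] [Fintype c] [DecidableEq a]
  {ρ : Matrix (a × c) (a × c) ℂ}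

theorem trace_mul_one_kronecker (ρ : Matrix (a × c) (a × c) ℂ) (K : Matrix c c ℂ) :
    (ρ * (1 : Matrix a a ℂ) ⊗ₖ K).trace = (reduced ρ * K).trace := by
  rw [reduced_eq_sum_submatrix, Finset.sum_mul, trace_sum, trace, Fintype.sum_prod_type]
  refine Finset.sum_congr rfl fun i _ => Finset.sum_congr rfl fun k _ => ?_
  simp only [diag_apply, mul_apply, Fintype.sum_prod_type, kroneckerMap_apply, one_apply, ite_mul,
    one_mul, zero_mul, mul_ite, mul_zero, submatrix_apply]
  rw [Finset.sum_comm]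
  simp only [Finset.sum_ite_eq', Finset.mem_univ, if_true]

theorem cfc_one_kronecker [DecidableEq c] {σ : Matrix c c ℂ} (hσ : σ.IsHermitian) (f : ℝ → ℝ) :
    cfc f ((1 : Matrix a a ℂ) ⊗ₖ σ) = (1 : Matrix a a ℂ) ⊗ₖ cfc f σ := by
  have hV := isDiagonalization_eigenvalues hσ
  have hdiag : diagonal (fun s : a × c => (f (1 * hσ.eigenvalues s.2) : ℂ)) =
      (1 : Matrix a a ℂ) ⊗ₖ diagonal fun k => (f (hσ.eigenvalues k) : ℂ) := by
    rw [← diagonal_one, diagonal_kronecker_diagonal]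
    simp only [one_mul]
  rw [(isDiagonalization_one.kronecker hV).cfc_eq, hV.cfc_eq, hdiag, conjTranspose_kronecker,
    ← mul_kronecker_mul, ← mul_kronecker_mul, conjTranspose_one, one_mul, one_mul]

theorem condEntropy_eq_neg_relEntropy [DecidableEq c] (hρ : ρ.PosSemidef) :
    condEntropy ρ = -relEntropy ρ ((1 : Matrix a a ℂ) ⊗ₖ reduced ρ) := by
  rw [relEntropy, cfc_one_kronecker (reduced_posSemidef hρ).1, Matrix.mul_sub, trace_sub,
    trace_mul_one_kronecker, condEntropy, entropy, entropy, Complex.sub_re]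
  ring

theorem posSemidef_card_smul_sum_sub {ι k : Type*} [Fintype ι] [Finite k] {σ : Matrix c c ℂ}
    (hσ : σ.PosSemidef) (A : ι → Matrix k c ℂ) :
    ((Fintype.card ι : ℝ) • (∑ i, A i * σ * (A i)ᴴ) - (∑ i, A i) * σ * (∑ i, A i)ᴴ).PosSemidef := by
  have hpsd : (∑ i, ∑ j, (A i - A j) * σ * (A i - A j)ᴴ).PosSemidef :=
    posSemidef_sum _ fun i _ => posSemidef_sum _ fun j _ => hσ.mul_mul_conjTranspose_same _
  have hsum : ∑ i, ∑ j, (A i - A j) * σ * (A i - A j)ᴴ = (2 : ℝ) •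
      ((Fintype.card ι : ℝ) • (∑ i, A i * σ * (A i)ᴴ) - (∑ i, A i) * σ * (∑ i, A i)ᴴ) := by
    simp only [conjTranspose_sub, Matrix.sub_mul, Matrix.mul_sub, Finset.sum_sub_distrib,
      Finset.sum_const, Finset.card_univ, ← Matrix.mul_sum, ← Matrix.sum_mul,
      ← conjTranspose_sum, ← Finset.smul_sum, ← Nat.cast_smul_eq_nsmul ℝ]
    module
  have h := hpsd.smul (a := (2⁻¹ : ℝ)) (by norm_num)
  rwa [hsum, smul_smul, inv_mul_cancel₀ two_ne_zero, one_smul] at h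

theorem single_kronecker_one_mul_mul_conjTranspose [DecidableEq c]
    (ρ : Matrix (a × c) (a × c) ℂ) (i k : a) :
    single i k (1 : ℂ) ⊗ₖ (1 : Matrix c c ℂ) * ρ * (single i k (1 : ℂ) ⊗ₖ (1 : Matrix c c ℂ))ᴴ =
      single i i (1 : ℂ) ⊗ₖ ρ.submatrix (Prod.mk k) (Prod.mk k) := by
  ext ⟨x, z⟩ ⟨y, w⟩
  simp only [conjTranspose_kronecker, conjTranspose_single, conjTranspose_one, mul_apply,
    kroneckerMap_apply, single_apply, one_apply, Fintype.sum_prod_type, submatrix_apply]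
  by_cases hx : i = x <;> by_cases hy : i = y <;>
    simp [hx, hy, ite_and, Finset.sum_ite_eq]

theorem posSemidef_card_smul_one_kronecker_sub {c : Type*} [Finite c]
    {ρ : Matrix (a × c) (a × c) ℂ} (hρ : ρ.PosSemidef) :
    ((Fintype.card a : ℝ) • (1 : Matrix a a ℂ) ⊗ₖ reduced ρ - ρ).PosSemidef := by
  classical
  cases nonempty_fintype c
  let E (i k : a) : Matrix (a × c) (a × c) ℂ := single i k 1 ⊗ₖ 1
  let κ : Matrix a a ℂ →ₗ[ℂ] Matrix c c ℂ →ₗ[ℂ] Matrix (a × c) (a × c) ℂ := kroneckerBilinear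
  have hdiag : ∑ i, E i i = 1 := by
    rw [← one_kronecker_one, ← sum_single_one]
    exact (LinearMap.map_sum₂ κ _ _ _).symm
  have hsplit : (1 : Matrix a a ℂ) ⊗ₖ reduced ρ = ∑ i, E i i * ρ * (E i i)ᴴ +
      ∑ i, ∑ k ∈ Finset.univ.erase i, E i k * ρ * (E i k)ᴴ := by
    rw [← Finset.sum_add_distrib, ← sum_single_one]
    refine (LinearMap.map_sum₂ κ _ _ _).trans (Finset.sum_congr rfl fun i _ => ?_)
    rw [Finset.add_sum_erase _ (fun k => E i k * ρ * (E i k)ᴴ) (Finset.mem_univ i),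
      reduced_eq_sum_submatrix, map_sum]
    simp only [E, single_kronecker_one_mul_mul_conjTranspose]
    rfl
  have hpinch := posSemidef_card_smul_sum_sub hρ fun i => E i i
  have hoff : (∑ i, ∑ k ∈ Finset.univ.erase i, E i k * ρ * (E i k)ᴴ).PosSemidef :=
    posSemidef_sum _ fun i _ => posSemidef_sum _ fun k _ => hρ.mul_mul_conjTranspose_same _
  have h := hpinch.add (hoff.smul (Nat.cast_nonneg (α := ℝ) (Fintype.card a)))
  rw [hdiag, Matrix.one_mul, conjTranspose_one, Matrix.mul_one] at h
  rwa [hsplit, smul_add, add_sub_right_comm]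

theorem condEntropy_le_condEntropy_kronMap_id [Fintype d] [DecidableEq c] [DecidableEq d]
    {N : Matrix c c ℂ →ₗ[ℂ] Matrix d d ℂ} (hN : IsChannel N) (hρ : ρ.PosSemidef) :
    condEntropy ρ ≤ condEntropy (kronMap (.id : Matrix a a ℂ →ₗ[ℂ] Matrix a a ℂ) N ρ) := by
  have hN' := isChannel_id (m := a).kronMap hN
  have hσ : ((1 : Matrix a a ℂ) ⊗ₖ reduced ρ).PosSemidef :=
    PosSemidef.one.kronecker (reduced_posSemidef hρ)
  rw [condEntropy_eq_neg_relEntropy hρ, condEntropy_eq_neg_relEntropy (hN'.posSemidef hρ),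
    reduced_kronMap fun _ => rfl, neg_le_neg_iff]
  have h := relEntropy_map_le hN'.isPositiveOver hN'.tracePreserving hρ hσ
    (posSemidef_card_smul_one_kronecker_sub hρ)
  rwa [kronMap_kronecker] at h

end ConditionalEntropy

section ChainRule

variable {m n a b c d : Type*}

/-- A bipartite system with memory `c`, regarded as its first part with the second part absorbed
into the memory. -/
def absorb (ρ : Matrix ((m × n) × c) ((m × n) × c) ℂ) :
    Matrix (m × (n × c)) (m × (n × c)) ℂ :=
  ρ.submatrix (Equiv.prodAssoc m n c).symm (Equiv.prodAssoc m n c).symm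

theorem absorb_kronMap_kronMap (Φ : Matrix m m ℂ →ₗ[ℂ] Matrix a a ℂ)
    (Ψ : Matrix n n ℂ →ₗ[ℂ] Matrix b b ℂ) (Θ : Matrix c c ℂ →ₗ[ℂ] Matrix d d ℂ)
    (ρ : Matrix ((m × n) × c) ((m × n) × c) ℂ) :
    absorb (kronMap (kronMap Φ Ψ) Θ ρ) = kronMap Φ (kronMap Ψ Θ) (absorb ρ) :=
  rfl

variable [Fintype m] [Fintype n] [Fintype a] [Fintype b] [Fintype c]

theorem exists_isDensity [Nonempty m] : ∃ ρ : Matrix m m ℂ, IsDensity ρ := by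
  classical
  obtain ⟨i⟩ := ‹Nonempty m›
  refine ⟨diagonal (Pi.single i 1), PosSemidef.diagonal (Pi.single_nonneg.mpr zero_le_one), ?_⟩
  rw [trace_diagonal, Finset.sum_pi_single']
  exact if_pos (Finset.mem_univ i)

theorem isDensity_submatrix {ρ : Matrix m m ℂ} (hρ : IsDensity ρ) (e : n ≃ m) :
    IsDensity (ρ.submatrix e e) :=
  ⟨hρ.1.submatrix e, (e.sum_comp fun i => ρ i i).trans hρ.2⟩

theorem isDensity_absorb {ρ : Matrix ((m × n) × c) ((m × n) × c) ℂ} (hρ : IsDensity ρ) :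
    IsDensity (absorb ρ) :=
  isDensity_submatrix hρ _

theorem isDensity_reduced {ρ : Matrix (m × c) (m × c) ℂ} (hρ : IsDensity ρ) :
    IsDensity (reduced ρ) :=
  ⟨reduced_posSemidef hρ.1, (trace_reduced ρ).trans hρ.2⟩

variable [DecidableEq n] [DecidableEq a] [DecidableEq b] [DecidableEq c]
  {ρ : Matrix ((m × n) × c) ((m × n) × c) ℂ}

theorem condEntropy_eq_condEntropy_absorb_add [DecidableEq m] (hρ : ρ.PosSemidef) :
    condEntropy ρ = condEntropy (absorb ρ) + condEntropy (reduced (absorb ρ)) := by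
  have hreduced : reduced (reduced (absorb ρ)) = reduced ρ := by
    ext k l
    simp only [reduced, absorb, of_apply, submatrix_apply, Fintype.sum_prod_type_right]
    rfl
  rw [condEntropy, condEntropy, condEntropy, absorb, entropy_submatrix hρ.1, ← absorb, hreduced]
  ring

theorem condEntropy_add_condEntropy_reduced_absorb_le {Φ : Matrix m m ℂ →ₗ[ℂ] Matrix a a ℂ}
    {Ψ : Matrix n n ℂ →ₗ[ℂ] Matrix b b ℂ} (hΦ : IsChannel Φ) (hΨ : IsChannel Ψ)
    (hρ : ρ.PosSemidef) :
    condEntropy (kronMap Φ .id (absorb ρ)) + condEntropy (kronMap Ψ .id (reduced (absorb ρ))) ≤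
      condEntropy (kronMap (kronMap Φ Ψ) (.id : Matrix c c ℂ →ₗ[ℂ] Matrix c c ℂ) ρ) := by
  have hΨ' := hΨ.kronMap (isChannel_id (m := c))
  have hout := ((hΦ.kronMap hΨ).kronMap (isChannel_id (m := c))).posSemidef hρ
  have hfactor : kronMap .id (kronMap Ψ .id) (kronMap Φ .id (absorb ρ)) =
      kronMap Φ (kronMap Ψ (.id : Matrix c c ℂ →ₗ[ℂ] Matrix c c ℂ)) (absorb ρ) :=
    LinearMap.congr_fun (kronMap_comp_kronMap Φ .id .id (kronMap Ψ .id)) (absorb ρ)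
  rw [condEntropy_eq_condEntropy_absorb_add hout, absorb_kronMap_kronMap,
    reduced_kronMap hΦ.tracePreserving, ← hfactor]
  gcongr
  exact condEntropy_le_condEntropy_kronMap_id hΨ'
    ((hΦ.kronMap isChannel_id).posSemidef (hρ.submatrix _))

theorem condInfo_add_condInfo_le [DecidableEq m] {a' b' : Type*} [Fintype a'] [Fintype b']
    [DecidableEq a'] [DecidableEq b']
    {ΦA : Matrix m m ℂ →ₗ[ℂ] Matrix a a ℂ} {ΦB : Matrix m m ℂ →ₗ[ℂ] Matrix b b ℂ}
    {ΨA : Matrix n n ℂ →ₗ[ℂ] Matrix a' a' ℂ} {ΨB : Matrix n n ℂ →ₗ[ℂ] Matrix b' b' ℂ}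
    (hΦA : IsChannel ΦA) (hΦB : IsChannel ΦB) (hΨA : IsChannel ΨA) (hΨB : IsChannel ΨB)
    (hρ : ρ.PosSemidef) :
    condInfo ΦA ΦB (absorb ρ) + condInfo ΨA ΨB (reduced (absorb ρ)) ≤
      condInfo (kronMap ΦA ΨA) (kronMap ΦB ΨB) ρ := by
  have hA := condEntropy_add_condEntropy_reduced_absorb_le hΦA hΨA hρ
  have hB := condEntropy_add_condEntropy_reduced_absorb_le hΦB hΨB hρ
  have hM := condEntropy_eq_condEntropy_absorb_add hρ
  rw [condInfo, condInfo, condInfo]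
  linarith

end ChainRule

section ProductStates

variable {m n a b c d : Type*}

/-- The product `x ⊗ y` of two states with memories `c` and `d`, regarded as a state of the
composite system `m × n` with memory `c × d`. -/
def productState (x : Matrix (m × c) (m × c) ℂ) (y : Matrix (n × d) (n × d) ℂ) :
    Matrix ((m × n) × (c × d)) ((m × n) × (c × d)) ℂ :=
  (x ⊗ₖ y).submatrix (Equiv.prodProdProdComm m n c d) (Equiv.prodProdProdComm m n c d)

theorem kronMap_kronMap_id_productState (Φ : Matrix m m ℂ →ₗ[ℂ] Matrix a a ℂ)
    (Ψ : Matrix n n ℂ →ₗ[ℂ] Matrix b b ℂ) (x : Matrix (m × c) (m × c) ℂ)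
    (y : Matrix (n × d) (n × d) ℂ) :
    kronMap (kronMap Φ Ψ) .id (productState x y) =
      productState (kronMap Φ .id x) (kronMap Ψ .id y) := by
  ext ⟨s, k, l⟩ ⟨t, k', l'⟩
  exact congrFun₂ (kronMap_kronecker Φ Ψ (of fun i i' => x (i, k) (i', k'))
    (of fun j j' => y (j, l) (j', l'))) s t

variable [Fintype m] [Fintype n]

theorem reduced_productState (x : Matrix (m × c) (m × c) ℂ) (y : Matrix (n × d) (n × d) ℂ) :
    reduced (productState x y) = reduced x ⊗ₖ reduced y := by
  ext ⟨k, l⟩ ⟨k', l'⟩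
  simp only [reduced, productState, of_apply, submatrix_apply, kroneckerMap_apply,
    Fintype.sum_prod_type, Finset.sum_mul_sum]
  rfl

variable [Fintype c] [Fintype d] {x : Matrix (m × c) (m × c) ℂ} {y : Matrix (n × d) (n × d) ℂ}

theorem isDensity_productState (hx : IsDensity x) (hy : IsDensity y) :
    IsDensity (productState x y) :=
  isDensity_submatrix ⟨hx.1.kronecker hy.1, by rw [trace_kronecker, hx.2, hy.2, mul_one]⟩ _

variable [Fintype a] [Fintype b] [DecidableEq m] [DecidableEq n] [DecidableEq a] [DecidableEq b]
  [DecidableEq c] [DecidableEq d]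

theorem condEntropy_productState (hx : IsDensity x) (hy : IsDensity y) :
    condEntropy (productState x y) = condEntropy x + condEntropy y := by
  rw [condEntropy, reduced_productState, productState, entropy_submatrix (hx.1.kronecker hy.1).1,
    entropy_kronecker hx hy, entropy_kronecker (isDensity_reduced hx) (isDensity_reduced hy),
    condEntropy, condEntropy]
  ring

theorem condInfo_productState {a' b' : Type*} [Fintype a'] [Fintype b'] [DecidableEq a']
    [DecidableEq b'] {ΦA : Matrix m m ℂ →ₗ[ℂ] Matrix a a ℂ} {ΦB : Matrix m m ℂ →ₗ[ℂ] Matrix b b ℂ}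
    {ΨA : Matrix n n ℂ →ₗ[ℂ] Matrix a' a' ℂ} {ΨB : Matrix n n ℂ →ₗ[ℂ] Matrix b' b' ℂ}
    (hΦA : IsChannel ΦA) (hΦB : IsChannel ΦB) (hΨA : IsChannel ΨA) (hΨB : IsChannel ΨB)
    (hx : IsDensity x) (hy : IsDensity y) :
    condInfo (kronMap ΦA ΨA) (kronMap ΦB ΨB) (productState x y) =
      condInfo ΦA ΦB x + condInfo ΨA ΨB y := by
  rw [condInfo, kronMap_kronMap_id_productState, kronMap_kronMap_id_productState,
    condEntropy_productState hx hy,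
    condEntropy_productState ((hΦA.kronMap isChannel_id).isDensity hx)
      ((hΨA.kronMap isChannel_id).isDensity hy),
    condEntropy_productState ((hΦB.kronMap isChannel_id).isDensity hx)
      ((hΨB.kronMap isChannel_id).isDensity hy), condInfo, condInfo]
  ring

end ProductStates

section MinimalUncertainty

variable {m a b c d : Type*} [Fintype m] [Fintype a] [Fintype b] [Fintype c] [Fintype d]
  [DecidableEq m] [DecidableEq a] [DecidableEq b] [DecidableEq c] [DecidableEq d]
  {ΦA : Matrix m m ℂ →ₗ[ℂ] Matrix a a ℂ} {ΦB : Matrix m m ℂ →ₗ[ℂ] Matrix b b ℂ}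

theorem condEntropy_submatrix_memory {ρ : Matrix (m × c) (m × c) ℂ} (hρ : ρ.PosSemidef)
    (e : d ≃ c) :
    condEntropy (ρ.submatrix (Prod.map id e) (Prod.map id e)) = condEntropy ρ := by
  have hreduced : reduced (ρ.submatrix (Prod.map id e) (Prod.map id e)) =
      (reduced ρ).submatrix e e := rfl
  rw [condEntropy, condEntropy, hreduced, entropy_submatrix (reduced_posSemidef hρ).1]
  exact congrArg (· - _) (entropy_submatrix hρ.1 ((Equiv.refl m).prodCongr e))

theorem condInfo_submatrix_memory (hA : IsChannel ΦA) (hB : IsChannel ΦB)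
    {ρ : Matrix (m × c) (m × c) ℂ} (hρ : ρ.PosSemidef) (e : d ≃ c) :
    condInfo ΦA ΦB (ρ.submatrix (Prod.map id e) (Prod.map id e)) = condInfo ΦA ΦB ρ := by
  rw [condInfo, kronMap_id_submatrix, kronMap_id_submatrix, condEntropy_submatrix_memory hρ,
    condEntropy_submatrix_memory ((hA.kronMap isChannel_id).posSemidef hρ),
    condEntropy_submatrix_memory ((hB.kronMap isChannel_id).posSemidef hρ), condInfo]

theorem minUncertainty_le_condInfo_fin {k : ℕ} {ρ : Matrix (m × Fin k) (m × Fin k) ℂ}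
    (hρ : IsDensity ρ) : minUncertainty ΦA ΦB ≤ condInfo ΦA ΦB ρ :=
  (iInf_le _ k).trans
    (iInf_le (fun ρ : {ρ : Matrix (m × Fin k) (m × Fin k) ℂ // IsDensity ρ} =>
      (condInfo ΦA ΦB ρ.1 : EReal)) ⟨ρ, hρ⟩)

theorem minUncertainty_le_condInfo (hA : IsChannel ΦA) (hB : IsChannel ΦB)
    {ρ : Matrix (m × c) (m × c) ℂ} (hρ : IsDensity ρ) :
    minUncertainty ΦA ΦB ≤ condInfo ΦA ΦB ρ := by
  let e := (Fintype.equivFin c).symm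
  rw [← condInfo_submatrix_memory hA hB hρ.1 e]
  exact minUncertainty_le_condInfo_fin (isDensity_submatrix hρ ((Equiv.refl m).prodCongr e))

theorem exists_condInfo_lt {z : EReal} (hz : minUncertainty ΦA ΦB < z) :
    ∃ (k : ℕ) (ρ : Matrix (m × Fin k) (m × Fin k) ℂ), IsDensity ρ ∧ condInfo ΦA ΦB ρ < z := by
  obtain ⟨k, hk⟩ := iInf_lt_iff.mp hz
  obtain ⟨⟨ρ, hρ⟩, hlt⟩ := iInf_lt_iff.mp hk
  exact ⟨k, ρ, hρ, hlt⟩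

theorem minUncertainty_ne_top [Nonempty m] : minUncertainty ΦA ΦB ≠ ⊤ := by
  obtain ⟨ρ, hρ⟩ := exists_isDensity (m := m × Fin 1)
  exact ((minUncertainty_le_condInfo_fin hρ).trans_lt (EReal.coe_lt_top _)).ne

end MinimalUncertainty

section Additivity

variable {m a b n a' b' : Type*} [Fintype m] [Fintype a] [Fintype b] [Fintype n] [Fintype a']
  [Fintype b'] [DecidableEq m] [DecidableEq a] [DecidableEq b] [DecidableEq n] [DecidableEq a']
  [DecidableEq b'] {ΦA : Matrix m m ℂ →ₗ[ℂ] Matrix a a ℂ} {ΦB : Matrix m m ℂ →ₗ[ℂ] Matrix b b ℂ}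
  {ΨA : Matrix n n ℂ →ₗ[ℂ] Matrix a' a' ℂ} {ΨB : Matrix n n ℂ →ₗ[ℂ] Matrix b' b' ℂ}

theorem minUncertainty_kronMap_le [Nonempty m] [Nonempty n] (hΦA : IsChannel ΦA)
    (hΦB : IsChannel ΦB) (hΨA : IsChannel ΨA) (hΨB : IsChannel ΨB) :
    minUncertainty (kronMap ΦA ΨA) (kronMap ΦB ΨB) ≤
      minUncertainty ΦA ΦB + minUncertainty ΨA ΨB := by
  refine EReal.le_add_of_forall_gt (.inr minUncertainty_ne_top) (.inl minUncertainty_ne_top)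
    fun x hx y hy => ?_
  obtain ⟨k, ρ, hρ, hρx⟩ := exists_condInfo_lt hx
  obtain ⟨l, σ, hσ, hσy⟩ := exists_condInfo_lt hy
  calc minUncertainty (kronMap ΦA ΨA) (kronMap ΦB ΨB)
      ≤ condInfo (kronMap ΦA ΨA) (kronMap ΦB ΨB) (productState ρ σ) :=
        minUncertainty_le_condInfo (hΦA.kronMap hΨA) (hΦB.kronMap hΨB)
          (isDensity_productState hρ hσ)
    _ = (condInfo ΦA ΦB ρ : EReal) + condInfo ΨA ΨB σ := by
        rw [condInfo_productState hΦA hΦB hΨA hΨB hρ hσ, EReal.coe_add]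
    _ ≤ x + y := add_le_add hρx.le hσy.le

theorem le_minUncertainty_kronMap (hΦA : IsChannel ΦA) (hΦB : IsChannel ΦB) (hΨA : IsChannel ΨA)
    (hΨB : IsChannel ΨB) :
    minUncertainty ΦA ΦB + minUncertainty ΨA ΨB ≤
      minUncertainty (kronMap ΦA ΨA) (kronMap ΦB ΨB) := by
  refine le_iInf fun k => le_iInf fun ⟨ρ, hρ⟩ => ?_
  have habsorb := isDensity_absorb hρ
  calc minUncertainty ΦA ΦB + minUncertainty ΨA ΨB
      ≤ (condInfo ΦA ΦB (absorb ρ) : EReal) + condInfo ΨA ΨB (reduced (absorb ρ)) :=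
        add_le_add (minUncertainty_le_condInfo hΦA hΦB habsorb)
          (minUncertainty_le_condInfo hΨA hΨB (isDensity_reduced habsorb))
    _ ≤ condInfo (kronMap ΦA ΨA) (kronMap ΦB ΨB) ρ := by
        exact_mod_cast condInfo_add_condInfo_le hΦA hΦB hΨA hΨB hρ.1

end Additivity

end SquashedUncertainty

theorem mainTheorem4
    {m₁ a₁ b₁ m₂ a₂ b₂ : Type*}
    [Fintype m₁] [DecidableEq m₁] [Fintype a₁] [DecidableEq a₁] [Fintype b₁] [DecidableEq b₁]
    [Fintype m₂] [DecidableEq m₂] [Fintype a₂] [DecidableEq a₂] [Fintype b₂] [DecidableEq b₂]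
    [Nonempty m₁] [Nonempty m₂]
    (ΦA : Matrix m₁ m₁ ℂ →ₗ[ℂ] Matrix a₁ a₁ ℂ) (ΦB : Matrix m₁ m₁ ℂ →ₗ[ℂ] Matrix b₁ b₁ ℂ)
    (ΨA : Matrix m₂ m₂ ℂ →ₗ[ℂ] Matrix a₂ a₂ ℂ) (ΨB : Matrix m₂ m₂ ℂ →ₗ[ℂ] Matrix b₂ b₂ ℂ)
    (hΦA : SquashedUncertainty.IsChannel ΦA) (hΦB : SquashedUncertainty.IsChannel ΦB)
    (hΨA : SquashedUncertainty.IsChannel ΨA) (hΨB : SquashedUncertainty.IsChannel ΨB) :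
    SquashedUncertainty.minUncertainty (SquashedUncertainty.kronMap ΦA ΨA)
        (SquashedUncertainty.kronMap ΦB ΨB)
      = SquashedUncertainty.minUncertainty ΦA ΦB + SquashedUncertainty.minUncertainty ΨA ΨB := by
  open SquashedUncertainty in
  exact le_antisymm (minUncertainty_kronMap_le hΦA hΦB hΨA hΨB)
    (le_minUncertainty_kronMap hΦA hΦB hΨA hΨB)
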